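/- Let $d \ge 2$, let $\mathbb{S}^d$ be the unit sphere in $\mathbb{R}^{d+1}$, and let $\sigma_d$ be the surface area measure on $\mathbb{S}^d$ normalized so that $\sigma_d(\mathbb{S}^d)=1$. For $x \in \mathbb{S}^d$ and $t \in [-1,1]$ let $C(x,t) = \{ z \in \mathbb{S}^d : z \cdot x \ge t \}$ be the spherical cap with center $x$ and height parameter $t$. For points $x_1,\dots,x_N \in \mathbb{S}^d$ (not necessarily distinct, counted with multiplicity), the spherical cap $\mathbb{L}_2$-discrepancy is $$ D(x_1,\dots,x_N) = \left( \int_{-1}^1 \int_{\mathbb{S}^d} \left| \frac{|\{ k : x_k \in C(x,t) \}|}{N} - \sigma_d(C(x,t)) \right|^2 \, d\sigma_d(x) \, dt \right)^{1/2}. $$ Then there is a constant $c_d > 0$, depending only on $d$, such that for every $N \ge 1$ and all $x_1,\dots,x_N \in \mathbb{S}^d$, $$ D(x_1,\dots,x_N) \ge c_d \, N^{-\frac12 - \frac{1}{2d}}. $$ -/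

import Mathlib

open MeasureTheory

/-- The unit sphere `S^d` in the Euclidean space `ℝ^(d+1)`. -/
abbrev UnitSphere (d : ℕ) : Type :=
  Metric.sphere (0 : EuclideanSpace ℝ (Fin (d + 1))) 1

/-- The normalized surface area measure `σ_d` on `S^d`. -/
noncomputable def sphereMeasure (d : ℕ) : Measure (UnitSphere d) :=
  ((volume : Measure (EuclideanSpace ℝ (Fin (d + 1)))).toSphere Set.univ)⁻¹ •
    (volume : Measure (EuclideanSpace ℝ (Fin (d + 1)))).toSphere

instance sphereMeasure_isProbabilityMeasure (d : ℕ) :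
    IsProbabilityMeasure (sphereMeasure d) where
  measure_univ := by
    rw [sphereMeasure, Measure.smul_apply, smul_eq_mul]
    exact ENNReal.inv_mul_cancel
      (Measure.measure_univ_ne_zero.2 (Measure.toSphere_ne_zero _)) (measure_ne_top _ _)

/-- The closed spherical cap `C(x, t) = {z ∈ S^d : z · x ≥ t}`. -/
def sphericalCap {d : ℕ} (x : UnitSphere d) (t : ℝ) : Set (UnitSphere d) :=
  {z | t ≤ inner ℝ (z : EuclideanSpace ℝ (Fin (d + 1))) (x : EuclideanSpace ℝ (Fin (d + 1)))}

/-- The spherical cap `L²`-discrepancy of the points `p 0, …, p (N - 1)` of `S^d`; repeated points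
are counted with multiplicity. -/
noncomputable def capDiscrepancy {d N : ℕ} (p : Fin N → UnitSphere d) : ℝ :=
  Real.sqrt (∫ t in (-1 : ℝ)..1, ∫ x : UnitSphere d,
    |(({k : Fin N | p k ∈ sphericalCap x t}.ncard : ℝ) / (N : ℝ)) -
      (sphereMeasure d).real (sphericalCap x t)| ^ 2 ∂(sphereMeasure d))

/-! Let ν be the empirical measure minus σ_d. By Stolarsky's principle D² is a positive multiple of
-∬ |z - w| dν dν (`capDiscrepancy_sq`). The distance is a mixture of Gaussians, κ r = ∫₀^∞ (1 -
exp(-u² r²)) / u² du, and the constant 1 vanishes against ν; hence D² is a positive multiple of ∫₀^∞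
E(u) / u² du, where E(u) is the energy of ν for the kernel exp(-u² |z - w|²)
(`integral_mixedDifference_dist`).

Every E(u) is nonnegative, the kernel being positive definite. In E(u) the diagonal of the empirical
measure contributes at least 1/N, while each cross term with σ_d costs at most C / u^d
(`exists_integral_gaussian_sphere_le`). So E(u) ≥ 1/(2N) once u exceeds v, a multiple of N^(1/d),
and D² is at least of order ∫_v^∞ du / (N u²) = 1 / (N v), that is N^(-1 - 1/d).

Signed measures are avoided: with P the product of the empirical measure and σ_d, the energy of ν
for K is the integral of `mixedDifference K` over `P.prod P`. -/

/-! ### Rotation invariance and the mean of |x · e|. -/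

theorem exists_orthonormalBasis_zero_eq {d : ℕ} (z : EuclideanSpace ℝ (Fin (d + 1)))
    (hz : ‖z‖ = 1) :
    ∃ b : OrthonormalBasis (Fin (d + 1)) ℝ (EuclideanSpace ℝ (Fin (d + 1))), b 0 = z := by
  have h : Orthonormal ℝ (({0} : Set (Fin (d + 1))).domRestrict fun _ => z) := by
    refine ⟨fun _ => hz, fun i j hij => ?_⟩
    exact absurd (Subtype.ext (i.2.trans j.2.symm)) hij
  obtain ⟨b, hb⟩ := h.exists_orthonormalBasis_extension_of_card_eq (by simp)
  exact ⟨b, hb 0 rfl⟩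

/-- The map of the unit sphere to itself induced by a linear isometry. -/
noncomputable def sphereRotation {d : ℕ}
    (L : EuclideanSpace ℝ (Fin (d + 1)) ≃ₗᵢ[ℝ] EuclideanSpace ℝ (Fin (d + 1)))
    (w : UnitSphere d) : UnitSphere d :=
  ⟨L w, by simp⟩

theorem continuous_sphereRotation {d : ℕ}
    (L : EuclideanSpace ℝ (Fin (d + 1)) ≃ₗᵢ[ℝ] EuclideanSpace ℝ (Fin (d + 1))) :
    Continuous (sphereRotation L) :=
  (L.continuous.comp continuous_subtype_val).subtype_mk _

-- Up to a constant, the measure of `s` is the volume of the cone (0,1) • s, and a linear isometry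
-- carries cones to cones and preserves volume.
open scoped Pointwise in
theorem map_sphereRotation {d : ℕ}
    (L : EuclideanSpace ℝ (Fin (d + 1)) ≃ₗᵢ[ℝ] EuclideanSpace ℝ (Fin (d + 1))) :
    (sphereMeasure d).map (sphereRotation L) = sphereMeasure d := by
  rw [sphereMeasure, Measure.map_smul]
  congr 1
  ext s hs
  rw [Measure.map_apply (continuous_sphereRotation L).measurable hs,
    Measure.toSphere_apply' _ ((continuous_sphereRotation L).measurable hs),
    Measure.toSphere_apply' _ hs]
  congr 1
  have h : Set.Ioo (0 : ℝ) 1 • ((↑) '' (sphereRotation L ⁻¹' s) :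
      Set (EuclideanSpace ℝ (Fin (d + 1)))) = L ⁻¹' (Set.Ioo (0 : ℝ) 1 • ((↑) '' s)) := by
    ext x
    constructor
    · rintro ⟨r, hr, _, ⟨w, hw, rfl⟩, rfl⟩
      exact ⟨r, hr, _, ⟨_, hw, rfl⟩, by simp [sphereRotation]⟩
    · rintro ⟨r, hr, _, ⟨w, hw, rfl⟩, hx⟩
      refine ⟨r, hr, _, ⟨sphereRotation L.symm w, ?_, rfl⟩, ?_⟩
      · have : sphereRotation L (sphereRotation L.symm w) = w :=
          Subtype.ext (by simp [sphereRotation])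
        rwa [Set.mem_preimage, this]
      · apply L.injective
        simpa [sphereRotation] using hx
  rw [h]
  exact L.measurePreserving.measure_preimage_emb L.toHomeomorph.measurableEmbedding _

theorem integral_comp_sphereRotation {d : ℕ}
    (L : EuclideanSpace ℝ (Fin (d + 1)) ≃ₗᵢ[ℝ] EuclideanSpace ℝ (Fin (d + 1)))
    {f : UnitSphere d → ℝ} (hf : Continuous f) :
    ∫ x, f (sphereRotation L x) ∂sphereMeasure d = ∫ x, f x ∂sphereMeasure d := by
  conv_rhs => rw [← map_sphereRotation L]
  rw [integral_map (continuous_sphereRotation L).aemeasurable hf.aestronglyMeasurable]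

/-- The mean of `|x · e|` over `x ∈ S^d`, for any unit vector `e`. -/
noncomputable def meanAbsCoord (d : ℕ) : ℝ :=
  ∫ x : UnitSphere d, |(x : EuclideanSpace ℝ (Fin (d + 1))) 0| ∂sphereMeasure d

theorem integral_abs_inner_unit {d : ℕ} (z : EuclideanSpace ℝ (Fin (d + 1))) (hz : ‖z‖ = 1) :
    ∫ x : UnitSphere d, |inner ℝ z (x : EuclideanSpace ℝ (Fin (d + 1)))| ∂sphereMeasure d
      = meanAbsCoord d := by
  obtain ⟨b, rfl⟩ := exists_orthonormalBasis_zero_eq z hz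
  rw [meanAbsCoord, ← integral_comp_sphereRotation b.repr
    (f := fun x => |(x : EuclideanSpace ℝ (Fin (d + 1))) 0|) (by fun_prop)]
  simp [sphereRotation, OrthonormalBasis.repr_apply_apply]

theorem integral_abs_inner {d : ℕ} (v : EuclideanSpace ℝ (Fin (d + 1))) :
    ∫ x : UnitSphere d, |inner ℝ v (x : EuclideanSpace ℝ (Fin (d + 1)))| ∂sphereMeasure d
      = meanAbsCoord d * ‖v‖ := by
  rcases eq_or_ne v 0 with rfl | hv
  · simp
  · have h := integral_abs_inner_unit ((‖v‖)⁻¹ • v) (by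
      rw [norm_smul, norm_inv, norm_norm, inv_mul_cancel₀ (norm_ne_zero_iff.2 hv)])
    rw [← h, mul_comm, ← integral_const_mul]
    congr 1
    ext x
    rw [inner_smul_left, abs_mul]
    simp only [conj_trivial, abs_inv, abs_norm]
    field_simp [norm_ne_zero_iff.2 hv]

theorem Continuous.integrable_sphereMeasure {d : ℕ} {f : UnitSphere d → ℝ} (hf : Continuous f) :
    Integrable f (sphereMeasure d) :=
  hf.integrable_of_hasCompactSupport (HasCompactSupport.of_compactSpace f)

/-- On the sphere 1 = ∑ x_i² ≤ ∑ |x_i|; integrating gives 1 ≤ (d + 1) `meanAbsCoord d`. -/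
theorem meanAbsCoord_pos (d : ℕ) : 0 < meanAbsCoord d := by
  have hc (i : Fin (d + 1)) : ∫ x : UnitSphere d,
      |(x : EuclideanSpace ℝ (Fin (d + 1))) i| ∂sphereMeasure d = meanAbsCoord d := by
    rw [← integral_abs_inner_unit (EuclideanSpace.single i (1 : ℝ)) (by simp)]
    simp [EuclideanSpace.inner_single_left]
  have h1 : ∫ x : UnitSphere d, (1 : ℝ) ∂sphereMeasure d ≤
      ∫ x : UnitSphere d, ∑ i, |(x : EuclideanSpace ℝ (Fin (d + 1))) i| ∂sphereMeasure d := by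
    refine integral_mono (integrable_const _)
      (Continuous.integrable_sphereMeasure (by fun_prop)) fun x => ?_
    have hx : ∑ i, ((x : EuclideanSpace ℝ (Fin (d + 1))) i) ^ 2 = 1 := by
      rw [← EuclideanSpace.real_norm_sq_eq]
      simp
    have hle (i : Fin (d + 1)) : |(x : EuclideanSpace ℝ (Fin (d + 1))) i| ≤ 1 := by
      rw [← sq_le_one_iff_abs_le_one]
      refine le_of_le_of_eq ?_ hx
      exact Finset.single_le_sum (f := fun i => ((x : EuclideanSpace ℝ (Fin (d + 1))) i) ^ 2)
        (fun j _ => sq_nonneg _) (Finset.mem_univ i)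
    refine hx.symm.le.trans ?_
    refine Finset.sum_le_sum fun i _ => ?_
    rw [← sq_abs]
    nlinarith [hle i, abs_nonneg ((x : EuclideanSpace ℝ (Fin (d + 1))) i)]
  rw [integral_finsetSum _ fun i _ => Continuous.integrable_sphereMeasure (by fun_prop)] at h1
  simp only [hc, integral_const, probReal_univ, Finset.sum_const, Finset.card_univ,
    Fintype.card_fin, nsmul_eq_mul, smul_eq_mul, mul_one] at h1
  by_contra! h
  have : ((d + 1 : ℕ) : ℝ) * meanAbsCoord d ≤ 0 :=
    mul_nonpos_of_nonneg_of_nonpos (Nat.cast_nonneg _) h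
  linarith

/-! ### Gaussian mass on the sphere. -/

/-- Polar coordinates restricted to the unit ball: the radial measure r^d dr gives mass 1/(d+1) to
(0,1). This turns sphere integrals into Gaussian integrals on the whole space. -/
theorem lintegral_toSphere_le {d : ℕ} {F : UnitSphere d → ENNReal}
    {G : EuclideanSpace ℝ (Fin (d + 1)) → ENNReal} (hF : Measurable F) (hG : Measurable G)
    (h : ∀ (w : UnitSphere d) (r : ℝ), 0 < r → r < 1 → F w ≤ G (r • (w : EuclideanSpace ℝ _))) :
    ∫⁻ w, F w ∂(volume : Measure (EuclideanSpace ℝ (Fin (d + 1)))).toSphere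
      ≤ (d + 1 : ℕ) * ∫⁻ x, G x := by
  have hmp := (volume : Measure (EuclideanSpace ℝ (Fin (d + 1)))).measurePreserving_homeomorphUnitSphereProd
  have hV : Measure.volumeIoiPow (Module.finrank ℝ (EuclideanSpace ℝ (Fin (d + 1))) - 1)
      (Set.Iio (⟨1, Set.mem_Ioi.2 one_pos⟩ : Set.Ioi (0 : ℝ))) = ((d + 1 : ℕ) : ENNReal)⁻¹ := by
    rw [Measure.volumeIoiPow_apply_Iio]
    simp only [finrank_euclideanSpace, Fintype.card_fin, add_tsub_cancel_right, one_pow, one_div]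
    rw [ENNReal.ofReal_inv_of_pos (by positivity)]
    congr 1
    exact_mod_cast ENNReal.ofReal_natCast (d + 1)
  have key : (∫⁻ w, F w ∂(volume : Measure (EuclideanSpace ℝ (Fin (d + 1)))).toSphere) *
      ((d + 1 : ℕ) : ENNReal)⁻¹ ≤ ∫⁻ x, G x := by
    calc _ = ∫⁻ q : UnitSphere d × Set.Ioi (0 : ℝ),
          F q.1 * (Set.Iio (⟨1, Set.mem_Ioi.2 one_pos⟩ : Set.Ioi (0 : ℝ))).indicator 1 q.2
          ∂((volume : Measure (EuclideanSpace ℝ (Fin (d + 1)))).toSphere.prod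
            (Measure.volumeIoiPow (Module.finrank ℝ (EuclideanSpace ℝ (Fin (d + 1))) - 1))) := by
          rw [lintegral_prod_mul hF.aemeasurable
            (measurable_one.indicator measurableSet_Iio).aemeasurable,
            lintegral_indicator_one measurableSet_Iio, hV]
      _ ≤ ∫⁻ q : UnitSphere d × Set.Ioi (0 : ℝ), G ((q.2 : ℝ) • (q.1 : EuclideanSpace ℝ _))
          ∂((volume : Measure (EuclideanSpace ℝ (Fin (d + 1)))).toSphere.prod
            (Measure.volumeIoiPow (Module.finrank ℝ (EuclideanSpace ℝ (Fin (d + 1))) - 1))) := by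
          refine lintegral_mono fun q => ?_
          by_cases hq : q.2 < (⟨1, Set.mem_Ioi.2 one_pos⟩ : Set.Ioi (0 : ℝ))
          · simpa [Set.indicator_of_mem, hq] using h q.1 q.2 q.2.2 hq
          · simp [Set.indicator_of_notMem, hq]
      _ = ∫⁻ x : ({0}ᶜ : Set (EuclideanSpace ℝ (Fin (d + 1)))), G x.1
            ∂(volume.comap Subtype.val) := by
          rw [← hmp.lintegral_comp (by fun_prop)]
          refine lintegral_congr fun x => ?_
          congr 1
          have hx : ‖(x : EuclideanSpace ℝ (Fin (d + 1)))‖ ≠ 0 := norm_ne_zero_iff.2 x.2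
          simp [smul_smul, hx]
      _ = ∫⁻ x in ({0}ᶜ : Set (EuclideanSpace ℝ (Fin (d + 1)))), G x :=
          lintegral_subtype_comap (measurableSet_singleton _).compl _
      _ ≤ ∫⁻ x, G x := setLIntegral_le_lintegral _ _
  rw [← div_eq_mul_inv] at key
  rw [mul_comm]
  exact (ENNReal.div_le_iff (by simp) (by simp)).1 key

theorem integrable_exp_neg_sum_mul_sq {n : ℕ} {a : Fin n → ℝ} (ha : ∀ i, 0 < a i) :
    Integrable fun y : EuclideanSpace ℝ (Fin n) => Real.exp (-∑ i, a i * y i ^ 2) := by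
  have h := Integrable.fintype_prod (f := fun (i : Fin n) (t : ℝ) => Real.exp (-a i * t ^ 2))
    (μ := fun _ => volume) fun i => integrable_exp_neg_mul_sq (ha i)
  have h' := ((EuclideanSpace.volume_preserving_symm_measurableEquiv_toLp (Fin n)).integrable_comp_emb
    (MeasurableEquiv.measurableEmbedding _)).2 h
  refine h'.congr (.of_forall fun y => ?_)
  simp [← Real.exp_sum]

theorem integral_exp_neg_sum_mul_sq {n : ℕ} (a : Fin n → ℝ) :
    ∫ y : EuclideanSpace ℝ (Fin n), Real.exp (-∑ i, a i * y i ^ 2)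
      = ∏ i, Real.sqrt (Real.pi / a i) := by
  have h := integral_fintype_prod_volume_eq_prod
    (fun (i : Fin n) (t : ℝ) => Real.exp (-a i * t ^ 2))
  simp only [integral_gaussian] at h
  rw [← h, ← (EuclideanSpace.volume_preserving_symm_measurableEquiv_toLp (Fin n)).integral_comp
    (MeasurableEquiv.measurableEmbedding _)]
  congr 1
  ext y
  simp [← Real.exp_sum]

/-- The mass of a Gaussian of width `1 / u` centred on the unit sphere. -/
theorem exists_integral_gaussian_sphere_le (d : ℕ) :
    ∃ C : ℝ, 0 < C ∧ ∀ (u : ℝ), 0 < u → ∀ z : UnitSphere d,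
      ∫ w : UnitSphere d, Real.exp (-(u ^ 2 * dist z w ^ 2)) ∂sphereMeasure d ≤ C / u ^ d := by
  set M := ((volume : Measure (EuclideanSpace ℝ (Fin (d + 1)))).toSphere Set.univ)⁻¹ with hM
  have hMtop : M ≠ ⊤ :=
    ENNReal.inv_ne_top.2 (Measure.measure_univ_ne_zero.2 (Measure.toSphere_ne_zero _))
  have hM0 : M ≠ 0 := ENNReal.inv_ne_zero.2 (measure_ne_top _ _)
  refine ⟨M.toReal * ((d + 1 : ℕ) * (Real.exp 1 * (Real.sqrt Real.pi * Real.sqrt Real.pi ^ d))),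
    mul_pos (ENNReal.toReal_pos hM0 hMtop) (by positivity), fun u hu z => ?_⟩
  obtain ⟨b, hb⟩ := exists_orthonormalBasis_zero_eq (z : EuclideanSpace ℝ (Fin (d + 1))) (by simp)
  -- The majorant has width 1 along z and 1/u in the d orthogonal directions, so its mass scales
  -- like u^(-d) and not u^(-d-1).
  set a : Fin (d + 1) → ℝ := Fin.cons 1 fun _ => u ^ 2 with ha
  have hapos (i : Fin (d + 1)) : 0 < a i := by
    refine Fin.cases ?_ (fun j => ?_) i <;> simp [ha] ; positivity
  set g : EuclideanSpace ℝ (Fin (d + 1)) → ℝ := fun x =>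
    Real.exp 1 * Real.exp (-∑ i, a i * (b.repr x) i ^ 2) with hg
  have hgint : Integrable g :=
    ((b.measurePreserving_repr.integrable_comp_emb b.repr.toHomeomorph.measurableEmbedding).2
      (integrable_exp_neg_sum_mul_sq hapos)).const_mul _
  have hgval : ∫ x, g x = Real.exp 1 * (Real.sqrt Real.pi * Real.sqrt Real.pi ^ d) / u ^ d := by
    rw [hg, integral_const_mul, b.measurePreserving_repr.integral_comp
      b.repr.toHomeomorph.measurableEmbedding fun y => Real.exp (-∑ i, a i * y i ^ 2),
      integral_exp_neg_sum_mul_sq, Fin.prod_univ_succ]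
    simp only [ha, Fin.cons_zero, Fin.cons_succ, Finset.prod_const, Finset.card_univ,
      Fintype.card_fin, div_one, Real.sqrt_div Real.pi_pos.le, Real.sqrt_sq hu.le, div_pow]
    ring
  have hle (w : UnitSphere d) (r : ℝ) (h0 : 0 < r) (h1 : r < 1) :
      Real.exp (-(u ^ 2 * dist z w ^ 2)) ≤ g (r • (w : EuclideanSpace ℝ (Fin (d + 1)))) := by
    rw [hg]
    simp only
    rw [← Real.exp_add]
    refine Real.exp_le_exp.2 ?_
    set y := b.repr (r • (w : EuclideanSpace ℝ (Fin (d + 1)))) with hy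
    set s : ℝ := inner ℝ (z : EuclideanSpace ℝ (Fin (d + 1))) w with hs
    have hy0 : y 0 = r * s := by
      rw [hy, b.repr_apply_apply, hb, inner_smul_right]
    have hysum : y 0 ^ 2 + ∑ i : Fin d, y i.succ ^ 2 = r ^ 2 := by
      rw [← Fin.sum_univ_succ fun i => y i ^ 2, ← EuclideanSpace.real_norm_sq_eq, hy,
        LinearIsometryEquiv.norm_map, norm_smul]
      simp
    have hdist : dist z w ^ 2 = 2 - 2 * s := by
      rw [Subtype.dist_eq, dist_eq_norm, norm_sub_sq_real]
      simp [hs]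
      ring
    have hs1 : |s| ≤ 1 := by
      simpa using abs_real_inner_le_norm (z : EuclideanSpace ℝ (Fin (d + 1))) w
    rw [Fin.sum_univ_succ]
    simp only [ha, Fin.cons_zero, Fin.cons_succ, ← Finset.mul_sum]
    rw [hdist, eq_sub_of_add_eq' hysum, hy0]
    have hs2 := abs_le.1 hs1
    have hr2 : r ^ 2 ≤ 1 := by nlinarith
    have hss : s ^ 2 ≤ 1 := by nlinarith
    -- The squared distance from r w to the line through z is at most |z - w|². The factor `Real.exp
    -- 1` in `g` absorbs the component along z, bounded in `e2`.
    have e1 : r ^ 2 - (r * s) ^ 2 ≤ 2 - 2 * s := by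
      nlinarith [mul_nonneg (sub_nonneg.2 hr2) (sub_nonneg.2 hss)]
    have e2 : (r * s) ^ 2 ≤ 1 := by
      rw [mul_pow]; nlinarith [sq_nonneg r, sq_nonneg s]
    nlinarith [mul_le_mul_of_nonneg_left e1 (sq_nonneg u)]
  have hcont : Continuous fun w : UnitSphere d => Real.exp (-(u ^ 2 * dist z w ^ 2)) := by fun_prop
  have hlint := lintegral_toSphere_le
    (F := fun w : UnitSphere d => ENNReal.ofReal (Real.exp (-(u ^ 2 * dist z w ^ 2))))
    (G := fun x => ENNReal.ofReal (g x)) hcont.measurable.ennreal_ofReal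
    (by rw [hg]; fun_prop) fun w r h0 h1 => ENNReal.ofReal_le_ofReal (hle w r h0 h1)
  rw [← ofReal_integral_eq_lintegral_ofReal hgint
    (.of_forall fun x => by rw [hg]; positivity), hgval] at hlint
  rw [integral_eq_lintegral_of_nonneg_ae (.of_forall fun w => Real.exp_nonneg _)
    hcont.aestronglyMeasurable, sphereMeasure, lintegral_smul_measure, smul_eq_mul,
    ENNReal.toReal_mul, ← hM, mul_div_assoc, mul_div_assoc]
  refine mul_le_mul_of_nonneg_left ?_ ENNReal.toReal_nonneg
  refine ENNReal.toReal_le_of_le_ofReal (by positivity) (hlint.trans_eq ?_)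
  rw [ENNReal.ofReal_mul (Nat.cast_nonneg _), ENNReal.ofReal_natCast]

/-! ### Energies as integrals of squares; positive definiteness of the Gaussian kernel. -/

/-- The square is a double integral, and Fubini applies because ψ² dominates. It serves both for
Gaussians on the ambient space and for cap indicators. -/
theorem integral_sq_integral {Y Ω : Type*} [MeasurableSpace Y] [MeasurableSpace Ω]
    (P : Measure Y) [IsProbabilityMeasure P] (m : Measure Ω) [SFinite m] {f : Y → Ω → ℝ}
    (hf : Measurable (Function.uncurry f)) {ψ : Ω → ℝ} (hψ : Integrable (fun ω => ψ ω ^ 2) m)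
    (hb : ∀ y ω, |f y ω| ≤ ψ ω) :
    ∫ ω, (∫ y, f y ω ∂P) ^ 2 ∂m = ∫ q : Y × Y, ∫ ω, f q.1 ω * f q.2 ω ∂m ∂(P.prod P) := by
  rw [integral_integral_swap]
  · congr 1
    ext ω
    rw [integral_prod_mul (fun y => f y ω) fun y => f y ω, sq]
  · refine (hψ.comp_snd (P.prod P)).mono' ?_ (.of_forall fun x => ?_)
    · exact ((hf.comp ((measurable_fst.comp measurable_fst).prodMk measurable_snd)).mul
        (hf.comp ((measurable_snd.comp measurable_fst).prodMk measurable_snd))).aestronglyMeasurable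
    · simp only [Function.uncurry, Real.norm_eq_abs, abs_mul, sq]
      exact mul_le_mul (hb _ _) (hb _ _) (abs_nonneg _) ((abs_nonneg _).trans (hb x.1.1 _))

/-- The second difference `K(z, z') - K(z, w') - K(w, z') + K(w, w')` of a kernel. -/
def mixedDifference {X : Type*} (K : X → X → ℝ) (q : (X × X) × (X × X)) : ℝ :=
  K q.1.1 q.2.1 - K q.1.1 q.2.2 - K q.1.2 q.2.1 + K q.1.2 q.2.2

theorem integral_mixedDifference {X Ω : Type*} [MeasurableSpace Ω] (m : Measure Ω)
    {h : X → X → Ω → ℝ} (hi : ∀ z w, Integrable (h z w) m) (q : (X × X) × (X × X)) :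
    ∫ ω, mixedDifference (fun z w => h z w ω) q ∂m
      = mixedDifference (fun z w => ∫ ω, h z w ω ∂m) q := by
  have h1 := integral_sub (hi q.1.1 q.2.1) (hi q.1.1 q.2.2)
  have h2 := integral_sub ((hi q.1.1 q.2.1).sub (hi q.1.1 q.2.2)) (hi q.1.2 q.2.1)
  have h3 := integral_add (((hi q.1.1 q.2.1).sub (hi q.1.1 q.2.2)).sub (hi q.1.2 q.2.1))
    (hi q.1.2 q.2.2)
  simp only [Pi.sub_apply] at h2 h3
  simp only [mixedDifference]
  rw [h3, h2, h1]

theorem mixedDifference_mul_mul {X : Type*} (g : X → ℝ) (q : (X × X) × (X × X)) :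
    mixedDifference (fun z w => g z * g w) q
      = (g q.1.1 - g q.1.2) * (g q.2.1 - g q.2.2) := by
  simp only [mixedDifference]
  ring

/-- The Gaussian kernel `exp (-u² |z - w|²)`. -/
noncomputable def gaussianKernel {X : Type*} [PseudoMetricSpace X] (u : ℝ) (z w : X) : ℝ :=
  Real.exp (-(u ^ 2 * dist z w ^ 2))

theorem integrable_exp_neg_mul_norm_sq {n : ℕ} {b : ℝ} (hb : 0 < b) :
    Integrable fun y : EuclideanSpace ℝ (Fin n) => Real.exp (-(b * ‖y‖ ^ 2)) := by
  refine (integrable_exp_neg_sum_mul_sq (n := n) (a := fun _ => b) fun _ => hb).congr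
    (.of_forall fun y => ?_)
  simp only [EuclideanSpace.real_norm_sq_eq, Finset.mul_sum]

/-- Completing the square about the midpoint of z and w, by the parallelogram law. -/
theorem exp_mul_exp_eq_gaussianKernel_mul {d : ℕ} (u : ℝ) (z w : UnitSphere d)
    (y : EuclideanSpace ℝ (Fin (d + 1))) :
    Real.exp (-(2 * u ^ 2 * ‖y - z‖ ^ 2)) * Real.exp (-(2 * u ^ 2 * ‖y - w‖ ^ 2))
      = gaussianKernel u z w * Real.exp (-(4 * u ^ 2 *
        ‖y - (2⁻¹ : ℝ) • ((z : EuclideanSpace ℝ (Fin (d + 1))) + w)‖ ^ 2)) := by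
  have key (a b : EuclideanSpace ℝ (Fin (d + 1))) :
      2 * ‖y - a‖ ^ 2 + 2 * ‖y - b‖ ^ 2 = 4 * ‖y - (2⁻¹ : ℝ) • (a + b)‖ ^ 2 + ‖a - b‖ ^ 2 := by
    have h := parallelogram_law_with_norm ℝ (y - a) (y - b)
    have e1 : y - a + (y - b) = (2 : ℝ) • (y - (2⁻¹ : ℝ) • (a + b)) := by module
    have e2 : y - a - (y - b) = -(a - b) := by abel
    rw [e1, e2, norm_smul, norm_neg, Real.norm_ofNat] at h
    linear_combination -h
  rw [gaussianKernel, ← Real.exp_add, ← Real.exp_add, Subtype.dist_eq, dist_eq_norm]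
  congr 1
  linear_combination (-u ^ 2) * key z w

theorem integral_exp_mul_exp {d : ℕ} (u : ℝ) (z w : UnitSphere d) :
    ∫ y : EuclideanSpace ℝ (Fin (d + 1)),
        Real.exp (-(2 * u ^ 2 * ‖y - z‖ ^ 2)) * Real.exp (-(2 * u ^ 2 * ‖y - w‖ ^ 2))
      = gaussianKernel u z w *
        ∫ y : EuclideanSpace ℝ (Fin (d + 1)), Real.exp (-(4 * u ^ 2 * ‖y‖ ^ 2)) := by
  simp only [exp_mul_exp_eq_gaussianKernel_mul]
  rw [integral_const_mul, integral_sub_right_eq_self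
    fun y : EuclideanSpace ℝ (Fin (d + 1)) => Real.exp (-(4 * u ^ 2 * ‖y‖ ^ 2))]

theorem integrable_exp_mul_exp {d : ℕ} {u : ℝ} (hu : 0 < u) (z w : UnitSphere d) :
    Integrable fun y : EuclideanSpace ℝ (Fin (d + 1)) =>
        Real.exp (-(2 * u ^ 2 * ‖y - z‖ ^ 2)) * Real.exp (-(2 * u ^ 2 * ‖y - w‖ ^ 2)) := by
  simp only [exp_mul_exp_eq_gaussianKernel_mul]
  exact ((integrable_exp_neg_mul_norm_sq (by positivity)).comp_sub_right _).const_mul _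

/-- Up to the factor `I`, the kernel is the L² inner product of narrower Gaussians centred at z and
w, so the energy is the integral of a square. -/
theorem integral_mixedDifference_gaussianKernel_nonneg {d : ℕ} {u : ℝ} (hu : 0 < u)
    (P : Measure (UnitSphere d × UnitSphere d)) [IsProbabilityMeasure P] :
    0 ≤ ∫ q, mixedDifference (gaussianKernel u) q ∂(P.prod P) := by
  set g : UnitSphere d → EuclideanSpace ℝ (Fin (d + 1)) → ℝ :=
    fun z y => Real.exp (-(2 * u ^ 2 * ‖y - z‖ ^ 2)) with hg
  set I : ℝ := ∫ y : EuclideanSpace ℝ (Fin (d + 1)), Real.exp (-(4 * u ^ 2 * ‖y‖ ^ 2)) with hI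
  have hIpos : 0 < I := integral_exp_pos (integrable_exp_neg_mul_norm_sq (by positivity))
  have hgb (z : UnitSphere d) (y : EuclideanSpace ℝ (Fin (d + 1))) :
      g z y ≤ Real.exp (2 * u ^ 2) * Real.exp (-(u ^ 2 * ‖y‖ ^ 2)) := by
    rw [hg, ← Real.exp_add]
    refine Real.exp_le_exp.2 ?_
    have h1 : ‖y‖ ≤ ‖y - z‖ + 1 := by
      simpa using norm_le_norm_sub_add y (z : EuclideanSpace ℝ (Fin (d + 1)))
    have h2 : ‖y‖ ^ 2 ≤ 2 * ‖y - z‖ ^ 2 + 2 := by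
      nlinarith [norm_nonneg y, sq_nonneg (‖y - z‖ - 1)]
    nlinarith [mul_le_mul_of_nonneg_left h2 (sq_nonneg u)]
  have key := integral_sq_integral P (volume : Measure (EuclideanSpace ℝ (Fin (d + 1))))
    (f := fun p y => g p.1 y - g p.2 y)
    (ψ := fun y => Real.exp (2 * u ^ 2) * Real.exp (-(u ^ 2 * ‖y‖ ^ 2)))
    (by simp only [hg, Function.uncurry_def]; fun_prop)
    (by
      have := (integrable_exp_neg_mul_norm_sq (n := d + 1) (b := 2 * u ^ 2)
        (by positivity)).const_mul (Real.exp (4 * u ^ 2))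
      refine this.congr (.of_forall fun y => ?_)
      simp only [← Real.exp_add, ← Real.exp_nat_mul]
      congr 1
      push_cast
      ring)
    (fun p y => abs_sub_le_of_nonneg_of_le (Real.exp_nonneg _) (hgb _ _)
      (Real.exp_nonneg _) (hgb _ _))
  have hin (q : (UnitSphere d × UnitSphere d) × (UnitSphere d × UnitSphere d)) :
      ∫ y, (g q.1.1 y - g q.1.2 y) * (g q.2.1 y - g q.2.2 y)
        = I * mixedDifference (gaussianKernel u) q := by
    have hi (z w : UnitSphere d) : Integrable fun y => g z y * g w y :=
      integrable_exp_mul_exp hu z w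
    have hv (z w : UnitSphere d) : ∫ y, g z y * g w y = gaussianKernel u z w * I :=
      integral_exp_mul_exp u z w
    have he (y : EuclideanSpace ℝ (Fin (d + 1))) := mixedDifference_mul_mul (fun z => g z y) q
    simp only [← he]
    rw [integral_mixedDifference _ hi]
    simp only [hv, mixedDifference]
    ring
  simp only [hin] at key
  rw [integral_const_mul] at key
  have h0 : 0 ≤ I * ∫ q, mixedDifference (gaussianKernel u) q ∂(P.prod P) :=
    key ▸ integral_nonneg fun y => sq_nonneg _
  exact nonneg_of_mul_nonneg_right h0 hIpos

/-! ### The distance as a mixture of Gaussians. -/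

theorem one_sub_exp_neg_sq_div_le {u : ℝ} (hu : 0 < u) :
    (1 - Real.exp (-u ^ 2)) / u ^ 2 ≤ 2 * (1 + u ^ 2)⁻¹ := by
  have hv : 0 < u ^ 2 := by positivity
  rw [← div_eq_mul_inv, div_le_div_iff₀ hv (by positivity)]
  generalize u ^ 2 = v at hv ⊢
  rcases le_total v 1 with h | h
  · nlinarith [Real.one_sub_le_exp_neg v]
  · nlinarith [Real.exp_nonneg (-v)]

theorem le_one_sub_exp_neg_sq_div {u : ℝ} (hu : 0 < u) :
    (1 + u ^ 2)⁻¹ ≤ (1 - Real.exp (-u ^ 2)) / u ^ 2 := by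
  have hv : 0 < u ^ 2 := by positivity
  rw [inv_eq_one_div, div_le_div_iff₀ (by positivity) hv]
  generalize u ^ 2 = v at hv ⊢
  have h1 : (1 + v) * Real.exp (-v) ≤ 1 := by
    rw [Real.exp_neg, ← div_eq_mul_inv, div_le_one (Real.exp_pos v)]
    linarith [Real.add_one_le_exp v]
  linarith

/-- The constant `κ` in `∫₀^∞ (1 - exp (-u² r²)) / u² du = κ r`. -/
noncomputable def gaussianMixtureConst : ℝ :=
  ∫ u in Set.Ioi (0 : ℝ), (1 - Real.exp (-u ^ 2)) / u ^ 2

theorem integrableOn_one_sub_exp_neg_sq_div :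
    IntegrableOn (fun u : ℝ => (1 - Real.exp (-u ^ 2)) / u ^ 2) (Set.Ioi 0) := by
  refine (integrable_inv_one_add_sq.const_mul 2).integrableOn.mono'
    (Measurable.aestronglyMeasurable (by fun_prop)) ?_
  filter_upwards [ae_restrict_mem measurableSet_Ioi] with u hu
  rw [Real.norm_of_nonneg]
  · exact one_sub_exp_neg_sq_div_le hu
  · exact le_trans (by positivity) (le_one_sub_exp_neg_sq_div hu)

theorem gaussianMixtureConst_pos : 0 < gaussianMixtureConst := by
  refine lt_of_lt_of_le (b := ∫ u in Set.Ioi (0 : ℝ), (1 + u ^ 2)⁻¹) ?_ ?_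
  · rw [integral_Ioi_inv_one_add_sq]
    simpa using Real.pi_pos
  · exact setIntegral_mono_on integrable_inv_one_add_sq.integrableOn
      integrableOn_one_sub_exp_neg_sq_div measurableSet_Ioi
      fun u hu => le_one_sub_exp_neg_sq_div hu

theorem integral_one_sub_exp_neg_div {r : ℝ} (hr : 0 ≤ r) :
    ∫ u in Set.Ioi (0 : ℝ), (1 - Real.exp (-(u ^ 2 * r ^ 2))) / u ^ 2
      = gaussianMixtureConst * r := by
  rcases hr.eq_or_lt with rfl | hr
  · simp
  · have h := integral_comp_mul_left_Ioi (fun u => (1 - Real.exp (-u ^ 2)) / u ^ 2) 0 hr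
    rw [mul_zero, smul_eq_mul] at h
    rw [inv_mul_eq_div, eq_div_iff hr.ne'] at h
    rw [gaussianMixtureConst, ← h, ← integral_mul_const, ← integral_mul_const]
    congr 1
    ext u
    rw [mul_pow, mul_comm (r ^ 2)]
    field_simp

theorem integrableOn_one_sub_exp_neg_div {r : ℝ} (hr : 0 ≤ r) :
    IntegrableOn (fun u : ℝ => (1 - Real.exp (-(u ^ 2 * r ^ 2))) / u ^ 2) (Set.Ioi 0) := by
  rcases hr.eq_or_lt with rfl | hr
  · simp
  · have h : IntegrableOn (fun u => (1 - Real.exp (-(r * u) ^ 2)) / (r * u) ^ 2) (Set.Ioi 0) :=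
      (integrableOn_Ioi_comp_mul_left_iff (fun u => (1 - Real.exp (-u ^ 2)) / u ^ 2) 0 hr).2
        (by simpa using integrableOn_one_sub_exp_neg_sq_div)
    refine IntegrableOn.congr_fun (Integrable.const_mul h (r ^ 2)) (fun u _ => ?_) measurableSet_Ioi
    rw [mul_pow, mul_comm (r ^ 2)]
    field_simp

/-- Constants cancel in a mixed difference; passing to 1 - K makes each term separately integrable
against du / u² near 0. -/
theorem mixedDifference_gaussianKernel_eq {X : Type*} [PseudoMetricSpace X] (u : ℝ)
    (q : (X × X) × (X × X)) :
    mixedDifference (gaussianKernel u) q =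
      -mixedDifference (fun z w => 1 - Real.exp (-(u ^ 2 * dist z w ^ 2))) q := by
  simp only [mixedDifference, gaussianKernel]
  ring

theorem integral_mixedDifference_gaussianKernel_div {X : Type*} [PseudoMetricSpace X]
    (q : (X × X) × (X × X)) :
    ∫ u in Set.Ioi (0 : ℝ), mixedDifference (gaussianKernel u) q / u ^ 2
      = -(gaussianMixtureConst * mixedDifference dist q) := by
  have hi (z w : X) := integrableOn_one_sub_exp_neg_div (dist_nonneg (x := z) (y := w))
  simp only [mixedDifference_gaussianKernel_eq, neg_div, integral_neg]
  congr 1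
  have he (u : ℝ) : mixedDifference (fun z w => 1 - Real.exp (-(u ^ 2 * dist z w ^ 2))) q / u ^ 2
      = mixedDifference (fun z w => (1 - Real.exp (-(u ^ 2 * dist z w ^ 2))) / u ^ 2) q := by
    simp only [mixedDifference]
    ring
  simp only [he]
  rw [integral_mixedDifference _ hi]
  simp only [integral_one_sub_exp_neg_div dist_nonneg, mixedDifference]
  ring

theorem abs_mixedDifference_gaussianKernel_div_le {d : ℕ} {u : ℝ} (hu : 0 < u)
    (q : (UnitSphere d × UnitSphere d) × (UnitSphere d × UnitSphere d)) :
    |mixedDifference (gaussianKernel u) q / u ^ 2| ≤ 16 * (1 + u ^ 2)⁻¹ := by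
  -- Since |z - w| ≤ 2, the bound at `2 * u` applies, which gives 8 = 4 · 2. Two terms of each sign
  -- then give 16.
  have h (z w : UnitSphere d) : 0 ≤ (1 - gaussianKernel u z w) / u ^ 2 ∧
      (1 - gaussianKernel u z w) / u ^ 2 ≤ 8 * (1 + u ^ 2)⁻¹ := by
    have hd : dist z w ≤ 2 := by
      rw [Subtype.dist_eq, dist_eq_norm]
      refine (norm_sub_le _ _).trans ?_
      simp
      norm_num
    have hd2 : dist z w ^ 2 ≤ 4 := by nlinarith [dist_nonneg (x := z) (y := w)]
    constructor
    · refine div_nonneg (sub_nonneg.2 (Real.exp_le_one_iff.2 ?_)) (sq_nonneg u)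
      exact neg_nonpos.2 (by positivity)
    · have h2 := one_sub_exp_neg_sq_div_le (u := 2 * u) (by positivity)
      have h3 : (1 - gaussianKernel u z w) / u ^ 2
          ≤ 4 * ((1 - Real.exp (-(2 * u) ^ 2)) / (2 * u) ^ 2) := by
        rw [mul_pow, div_le_iff₀ (by positivity)]
        have : Real.exp (-(2 ^ 2 * u ^ 2)) ≤ gaussianKernel u z w :=
          Real.exp_le_exp.2 (by nlinarith [mul_le_mul_of_nonneg_left hd2 (sq_nonneg u)])
        field_simp
        linarith
      have h4 : (1 + (2 * u) ^ 2)⁻¹ ≤ (1 + u ^ 2)⁻¹ :=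
        inv_anti₀ (by positivity) (by nlinarith [sq_nonneg u])
      linarith
  have e : mixedDifference (gaussianKernel u) q / u ^ 2 =
      -(1 - gaussianKernel u q.1.1 q.2.1) / u ^ 2 + (1 - gaussianKernel u q.1.1 q.2.2) / u ^ 2
      + (1 - gaussianKernel u q.1.2 q.2.1) / u ^ 2 - (1 - gaussianKernel u q.1.2 q.2.2) / u ^ 2 := by
    simp only [mixedDifference]
    ring
  rw [e, neg_div, abs_le]
  constructor <;> linarith [h q.1.1 q.2.1, h q.1.1 q.2.2, h q.1.2 q.2.1, h q.1.2 q.2.2]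

theorem integrable_mixedDifference_gaussianKernel_div {d : ℕ}
    (Q : Measure ((UnitSphere d × UnitSphere d) × (UnitSphere d × UnitSphere d)))
    [IsFiniteMeasure Q] :
    Integrable (fun x : ((UnitSphere d × UnitSphere d) × (UnitSphere d × UnitSphere d)) × ℝ =>
      mixedDifference (gaussianKernel x.2) x.1 / x.2 ^ 2)
      (Q.prod (volume.restrict (Set.Ioi 0))) := by
  refine ((integrable_inv_one_add_sq.const_mul 16).integrableOn.comp_snd Q).mono' ?_ ?_
  · refine Measurable.aestronglyMeasurable ?_
    simp only [mixedDifference, gaussianKernel]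
    fun_prop
  · have : ∀ᵐ x ∂(Q.prod (volume.restrict (Set.Ioi (0 : ℝ)))), x.2 ∈ Set.Ioi (0 : ℝ) :=
      Measure.quasiMeasurePreserving_snd.ae (ae_restrict_mem measurableSet_Ioi)
    filter_upwards [this] with x hx
    exact abs_mixedDifference_gaussianKernel_div_le hx x.1

theorem integral_mixedDifference_dist {d : ℕ}
    (Q : Measure ((UnitSphere d × UnitSphere d) × (UnitSphere d × UnitSphere d)))
    [IsFiniteMeasure Q] :
    -(gaussianMixtureConst * ∫ q, mixedDifference dist q ∂Q)
      = ∫ u in Set.Ioi (0 : ℝ), (∫ q, mixedDifference (gaussianKernel u) q ∂Q) / u ^ 2 := by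
  simp only [← integral_div]
  rw [← integral_integral_swap (integrable_mixedDifference_gaussianKernel_div Q),
    ← integral_const_mul, ← integral_neg]
  simp only [integral_mixedDifference_gaussianKernel_div]

theorem integrableOn_integral_mixedDifference_gaussianKernel_div {d : ℕ}
    (Q : Measure ((UnitSphere d × UnitSphere d) × (UnitSphere d × UnitSphere d)))
    [IsFiniteMeasure Q] :
    IntegrableOn (fun u : ℝ => (∫ q, mixedDifference (gaussianKernel u) q ∂Q) / u ^ 2)
      (Set.Ioi 0) := by
  simp only [← integral_div]
  exact (integrable_mixedDifference_gaussianKernel_div Q).integral_prod_right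

/-! ### Stolarsky's invariance principle. -/

theorem measurable_sphericalCap_indicator (d : ℕ) :
    Measurable fun y : UnitSphere d × ℝ × UnitSphere d =>
      (sphericalCap y.2.2 y.2.1).indicator (1 : UnitSphere d → ℝ) y.1 := by
  classical
  have h : MeasurableSet {y : UnitSphere d × ℝ × UnitSphere d |
      y.2.1 ≤ inner ℝ (y.1 : EuclideanSpace ℝ (Fin (d + 1))) y.2.2} :=
    measurableSet_le (by fun_prop) (by fun_prop)
  convert measurable_one.indicator h (β := ℝ) using 2
  simp [Set.indicator_apply, sphericalCap]

theorem indicator_one_mem_Icc {X : Type*} (s : Set X) (z : X) :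
    s.indicator (1 : X → ℝ) z ∈ Set.Icc (0 : ℝ) 1 := by
  by_cases h : z ∈ s <;> simp [h]

theorem abs_inner_sphere_le_one {d : ℕ} (z x : UnitSphere d) :
    |inner ℝ (z : EuclideanSpace ℝ (Fin (d + 1))) (x : EuclideanSpace ℝ (Fin (d + 1)))| ≤ 1 := by
  simpa using abs_real_inner_le_norm (z : EuclideanSpace ℝ (Fin (d + 1))) x

theorem integral_sphericalCap_indicator_mul_height {d : ℕ} (z w x : UnitSphere d) :
    ∫ t in Set.Ioc (-1 : ℝ) 1, (sphericalCap x t).indicator (1 : UnitSphere d → ℝ) z *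
        (sphericalCap x t).indicator (1 : UnitSphere d → ℝ) w
      = min (inner ℝ (z : EuclideanSpace ℝ (Fin (d + 1))) (x : EuclideanSpace ℝ (Fin (d + 1))))
          (inner ℝ (w : EuclideanSpace ℝ (Fin (d + 1))) (x : EuclideanSpace ℝ (Fin (d + 1)))) + 1 := by
  have hz := abs_le.1 (abs_inner_sphere_le_one z x)
  have hw := abs_le.1 (abs_inner_sphere_le_one w x)
  set s := min (inner ℝ (z : EuclideanSpace ℝ (Fin (d + 1))) (x : EuclideanSpace ℝ (Fin (d + 1))))
    (inner ℝ (w : EuclideanSpace ℝ (Fin (d + 1))) (x : EuclideanSpace ℝ (Fin (d + 1)))) with hs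
  have h (t : ℝ) : (sphericalCap x t).indicator (1 : UnitSphere d → ℝ) z *
        (sphericalCap x t).indicator (1 : UnitSphere d → ℝ) w
      = (Set.Iic s).indicator (1 : ℝ → ℝ) t := by
    simp [Set.indicator_apply, sphericalCap, hs, ← ite_and, and_comm]
  simp only [h]
  have hI : Set.Iic s ∩ Set.Ioc (-1) 1 = Set.Ioc (-1) s := by
    ext t
    simp only [Set.mem_inter_iff, Set.mem_Iic, Set.mem_Ioc]
    have : s ≤ 1 := (min_le_left _ _).trans hz.2
    constructor
    · tauto
    · exact fun ⟨h1, h2⟩ => ⟨h2, h1, h2.trans this⟩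
  rw [integral_indicator_one measurableSet_Iic, measureReal_restrict_apply measurableSet_Iic, hI,
    Real.volume_real_Ioc_of_le (le_min hz.1 hw.1)]
  ring

/-- From min(a, b) = (a + b - |a - b|) / 2 and the mean of |(z - w) · x|. The linear integrals may
stay unevaluated: each depends on one point only and cancels in a mixed difference. -/
theorem integral_min_inner {d : ℕ} (z w : UnitSphere d) :
    ∫ x : UnitSphere d,
        (min (inner ℝ (z : EuclideanSpace ℝ (Fin (d + 1))) (x : EuclideanSpace ℝ (Fin (d + 1))))
          (inner ℝ (w : EuclideanSpace ℝ (Fin (d + 1))) (x : EuclideanSpace ℝ (Fin (d + 1)))) + 1)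
          ∂sphereMeasure d
      = (∫ x : UnitSphere d, inner ℝ (z : EuclideanSpace ℝ (Fin (d + 1)))
            (x : EuclideanSpace ℝ (Fin (d + 1))) ∂sphereMeasure d) / 2
        + (∫ x : UnitSphere d, inner ℝ (w : EuclideanSpace ℝ (Fin (d + 1)))
            (x : EuclideanSpace ℝ (Fin (d + 1))) ∂sphereMeasure d) / 2
        + 1 - meanAbsCoord d / 2 * dist z w := by
  have hi (v : EuclideanSpace ℝ (Fin (d + 1))) : Integrable
      (fun x : UnitSphere d => inner ℝ v (x : EuclideanSpace ℝ (Fin (d + 1)))) (sphereMeasure d) :=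
    Continuous.integrable_sphereMeasure (by fun_prop)
  have hd := integral_abs_inner (z.1 - w.1)
  rw [Subtype.dist_eq, dist_eq_norm, div_mul_eq_mul_div, ← hd]
  have hmin (a b : ℝ) : min a b = a / 2 + b / 2 - |a - b| / 2 := by
    rcases le_total a b with h | h
    · rw [min_eq_left h, abs_of_nonpos (sub_nonpos.2 h)]; ring
    · rw [min_eq_right h, abs_of_nonneg (sub_nonneg.2 h)]; ring
  simp only [hmin, ← inner_sub_left]
  rw [integral_add _ (integrable_const _), integral_sub _ ((hi _).abs.div_const _),
    integral_add ((hi _).div_const _) ((hi _).div_const _), integral_div, integral_div,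
    integral_div, integral_const, probReal_univ, one_smul]
  · ring
  · exact Continuous.integrable_sphereMeasure (by fun_prop)
  · exact Continuous.integrable_sphereMeasure (by fun_prop)

theorem integrable_sphericalCap_indicator_mul {d : ℕ} (z w : UnitSphere d)
    (m : Measure (ℝ × UnitSphere d)) [IsFiniteMeasure m] :
    Integrable (fun ω => (sphericalCap ω.2 ω.1).indicator (1 : UnitSphere d → ℝ) z *
        (sphericalCap ω.2 ω.1).indicator (1 : UnitSphere d → ℝ) w) m := by
  refine Integrable.of_bound (C := 1) (Measurable.aestronglyMeasurable ?_) (.of_forall fun ω => ?_)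
  · exact ((measurable_sphericalCap_indicator d).comp measurable_prodMk_left).mul
      ((measurable_sphericalCap_indicator d).comp measurable_prodMk_left)
  · have h1 := indicator_one_mem_Icc (sphericalCap ω.2 ω.1) z
    have h2 := indicator_one_mem_Icc (sphericalCap ω.2 ω.1) w
    rw [Real.norm_of_nonneg (mul_nonneg h1.1 h2.1)]
    exact mul_le_one₀ h1.2 h2.1 h2.2

theorem integral_sphericalCap_indicator_mul {d : ℕ} (z w : UnitSphere d) :
    ∫ ω : ℝ × UnitSphere d, (sphericalCap ω.2 ω.1).indicator (1 : UnitSphere d → ℝ) z *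
        (sphericalCap ω.2 ω.1).indicator (1 : UnitSphere d → ℝ) w
        ∂((volume.restrict (Set.Ioc (-1) 1)).prod (sphereMeasure d))
      = (∫ x : UnitSphere d, inner ℝ (z : EuclideanSpace ℝ (Fin (d + 1)))
            (x : EuclideanSpace ℝ (Fin (d + 1))) ∂sphereMeasure d) / 2
        + (∫ x : UnitSphere d, inner ℝ (w : EuclideanSpace ℝ (Fin (d + 1)))
            (x : EuclideanSpace ℝ (Fin (d + 1))) ∂sphereMeasure d) / 2
        + 1 - meanAbsCoord d / 2 * dist z w := by
  rw [integral_prod_symm _ (integrable_sphericalCap_indicator_mul z w _), ← integral_min_inner]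
  simp only [integral_sphericalCap_indicator_mul_height]

/-- Stolarsky's invariance principle, for the difference of the marginals of `P`. -/
theorem integral_sq_integral_sphericalCap {d : ℕ} (P : Measure (UnitSphere d × UnitSphere d))
    [IsProbabilityMeasure P] :
    ∫ t in (-1 : ℝ)..1, ∫ x : UnitSphere d, (∫ q, ((sphericalCap x t).indicator 1 q.1 -
        (sphericalCap x t).indicator 1 q.2 : ℝ) ∂P) ^ 2 ∂sphereMeasure d
      = -(meanAbsCoord d / 2 * ∫ q, mixedDifference dist q ∂(P.prod P)) := by
  set g : UnitSphere d → ℝ × UnitSphere d → ℝ :=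
    fun z ω => (sphericalCap ω.2 ω.1).indicator (1 : UnitSphere d → ℝ) z with hg
  set m := (volume.restrict (Set.Ioc (-1 : ℝ) 1)).prod (sphereMeasure d) with hm
  have hgm : Measurable (Function.uncurry g) := measurable_sphericalCap_indicator d
  have hf : Measurable (Function.uncurry fun (p : UnitSphere d × UnitSphere d)
      (ω : ℝ × UnitSphere d) => g p.1 ω - g p.2 ω) :=
    (hgm.comp ((measurable_fst.comp measurable_fst).prodMk measurable_snd)).sub
      (hgm.comp ((measurable_snd.comp measurable_fst).prodMk measurable_snd))
  have hb (p : UnitSphere d × UnitSphere d) (ω : ℝ × UnitSphere d) : |g p.1 ω - g p.2 ω| ≤ 1 :=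
    abs_sub_le_of_nonneg_of_le (indicator_one_mem_Icc _ _).1 (indicator_one_mem_Icc _ _).2
      (indicator_one_mem_Icc _ _).1 (indicator_one_mem_Icc _ _).2
  have key := integral_sq_integral P m hf (ψ := fun _ => 1) (integrable_const _) hb
  have hi (z w : UnitSphere d) : Integrable (fun ω => g z ω * g w ω) m :=
    integrable_sphericalCap_indicator_mul z w m
  have hin (q : (UnitSphere d × UnitSphere d) × (UnitSphere d × UnitSphere d)) :
      ∫ ω, (g q.1.1 ω - g q.1.2 ω) * (g q.2.1 ω - g q.2.2 ω) ∂m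
        = -(meanAbsCoord d / 2 * mixedDifference dist q) := by
    have he (ω : ℝ × UnitSphere d) := mixedDifference_mul_mul (fun z => g z ω) q
    simp only [← he]
    rw [integral_mixedDifference _ hi]
    simp only [hg, hm, integral_sphericalCap_indicator_mul, mixedDifference]
    ring
  simp only [hin] at key
  rw [integral_neg, integral_const_mul] at key
  rw [← key, hm, integral_prod, intervalIntegral.integral_of_le (by norm_num)]
  refine Integrable.of_bound (C := 1) ?_ (.of_forall fun ω => ?_)
  · exact (hf.stronglyMeasurable.integral_prod_left.pow 2).aestronglyMeasurable
  · have : |∫ p, (g p.1 ω - g p.2 ω) ∂P| ≤ 1 := by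
      simpa using norm_integral_le_of_norm_le_const (μ := P) (f := fun p => g p.1 ω - g p.2 ω) (C := 1)
        (.of_forall fun p => hb p ω)
    simpa [abs_pow] using pow_le_one₀ (n := 2) (abs_nonneg _) this

/-! ### Energy of the empirical measure and the final estimate. -/

theorem integral_mixedDifference_prod {X : Type*} [TopologicalSpace X] [CompactSpace X]
    [SecondCountableTopology X] [MeasurableSpace X] [BorelSpace X] (μ ν : Measure X)
    [IsProbabilityMeasure μ] [IsProbabilityMeasure ν] {K : X → X → ℝ}
    (hK : Continuous (Function.uncurry K)) :
    ∫ q, mixedDifference K q ∂((μ.prod ν).prod (μ.prod ν))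
      = ∫ z, ∫ w, K z w ∂μ ∂μ - ∫ z, ∫ w, K z w ∂ν ∂μ - ∫ z, ∫ w, K z w ∂μ ∂ν
        + ∫ z, ∫ w, K z w ∂ν ∂ν := by
  have hi {f g : X × X → X} (hf : Continuous f) (hg : Continuous g) :
      Integrable (fun q : (X × X) × (X × X) => K (f q.1) (g q.2))
        ((μ.prod ν).prod (μ.prod ν)) := by
    have hc : Continuous fun q : (X × X) × (X × X) => K (f q.1) (g q.2) :=
      hK.comp ((hf.comp continuous_fst).prodMk (hg.comp continuous_snd))
    exact hc.integrable_of_hasCompactSupport (HasCompactSupport.of_compactSpace _)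
  have h11 := hi continuous_fst continuous_fst
  have h12 := hi continuous_fst continuous_snd
  have h21 := hi continuous_snd continuous_fst
  have h22 := hi continuous_snd continuous_snd
  have hfst (f : X → ℝ) : ∫ p : X × X, f p.1 ∂(μ.prod ν) = ∫ z, f z ∂μ := by
    rw [integral_fun_fst]; simp
  have hsnd (f : X → ℝ) : ∫ p : X × X, f p.2 ∂(μ.prod ν) = ∫ z, f z ∂ν := by
    rw [integral_fun_snd]; simp
  have h1 := integral_sub h11 h12
  have h2 := integral_sub (h11.sub h12) h21
  have h3 := integral_add ((h11.sub h12).sub h21) h22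
  simp only [Pi.sub_apply] at h2 h3
  simp only [mixedDifference]
  rw [h3, h2, h1, integral_prod _ h11, integral_prod _ h12, integral_prod _ h21,
    integral_prod _ h22]
  simp only [hfst (K _), hsnd (K _)]
  rw [hfst fun z => ∫ w, K z w ∂μ, hfst fun z => ∫ w, K z w ∂ν, hsnd fun z => ∫ w, K z w ∂μ,
    hsnd fun z => ∫ w, K z w ∂ν]

/-- The probability measure that gives mass `1 / N` to each of the points `p 0, …, p (N - 1)`. -/
noncomputable def empiricalMeasure {X : Type*} [MeasurableSpace X] {N : ℕ} (p : Fin N → X) :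
    Measure X :=
  (N : ENNReal)⁻¹ • ∑ k, Measure.dirac (p k)

theorem isProbabilityMeasure_empiricalMeasure {X : Type*} [MeasurableSpace X] {N : ℕ}
    (hN : 1 ≤ N) (p : Fin N → X) : IsProbabilityMeasure (empiricalMeasure p) where
  measure_univ := by
    have : (N : ENNReal) ≠ 0 := by exact_mod_cast (by omega : N ≠ 0)
    simp [empiricalMeasure, ENNReal.inv_mul_cancel this]

theorem integral_empiricalMeasure {X : Type*} [MeasurableSpace X] [MeasurableSingletonClass X]
    {N : ℕ} (p : Fin N → X) (f : X → ℝ) :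
    ∫ z, f z ∂empiricalMeasure p = (∑ k, f (p k)) / N := by
  rw [empiricalMeasure, integral_smul_measure,
    integral_finsetSum_measure fun k _ => integrable_dirac (by simp)]
  simp [integral_dirac, div_eq_inv_mul]

theorem capDiscrepancy_sq {d N : ℕ} (hN : 1 ≤ N) (p : Fin N → UnitSphere d) :
    capDiscrepancy p ^ 2 = -(meanAbsCoord d / 2 * ∫ q, mixedDifference dist q
      ∂(((empiricalMeasure p).prod (sphereMeasure d)).prod
        ((empiricalMeasure p).prod (sphereMeasure d)))) := by
  classical
  have := isProbabilityMeasure_empiricalMeasure hN p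
  have hcap (x : UnitSphere d) (t : ℝ) : MeasurableSet (sphericalCap x t) :=
    measurableSet_le (by fun_prop) (by fun_prop)
  have hind (x : UnitSphere d) (t : ℝ) (μ : Measure (UnitSphere d)) [IsProbabilityMeasure μ] :
      Integrable ((sphericalCap x t).indicator (1 : UnitSphere d → ℝ)) μ :=
    (integrable_const (1 : ℝ)).indicator (hcap x t)
  rw [← integral_sq_integral_sphericalCap, capDiscrepancy, Real.sq_sqrt]
  · congr 1
    ext t
    congr 1
    ext x
    rw [sq_abs, integral_sub ((hind x t _).comp_fst _) ((hind x t _).comp_snd _),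
      integral_fun_fst, integral_fun_snd, integral_empiricalMeasure,
      integral_indicator_one (hcap x t)]
    simp only [probReal_univ, one_smul]
    congr 3
    rw [Set.ncard_eq_toFinset_card']
    simp [Set.indicator_apply]
  · exact intervalIntegral.integral_nonneg (by norm_num) fun t _ =>
      integral_nonneg fun x => by positivity

/-- The N diagonal pairs, of weight 1/N² each, give 1/N; the two cross terms cost at most δ each;
the remaining terms are nonnegative. -/
theorem le_integral_mixedDifference_gaussianKernel {d N : ℕ} (hN : 1 ≤ N)
    (p : Fin N → UnitSphere d) {u δ : ℝ}
    (hδ : ∀ z : UnitSphere d, ∫ w, gaussianKernel u z w ∂sphereMeasure d ≤ δ) :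
    1 / (N : ℝ) - 2 * δ ≤ ∫ q, mixedDifference (gaussianKernel u) q
      ∂(((empiricalMeasure p).prod (sphereMeasure d)).prod
        ((empiricalMeasure p).prod (sphereMeasure d))) := by
  have := isProbabilityMeasure_empiricalMeasure hN p
  have hN0 : (0 : ℝ) < N := by exact_mod_cast hN
  have hcont : Continuous (Function.uncurry (gaussianKernel (X := UnitSphere d) u)) := by
    simp only [Function.uncurry_def, gaussianKernel]
    fun_prop
  have hpos (z w : UnitSphere d) : 0 ≤ gaussianKernel u z w := Real.exp_nonneg _
  have hsymm (z w : UnitSphere d) : gaussianKernel u z w = gaussianKernel u w z := by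
    rw [gaussianKernel, dist_comm, gaussianKernel]
  have hself (z : UnitSphere d) : gaussianKernel u z z = 1 := by simp [gaussianKernel]
  rw [integral_mixedDifference_prod _ _ hcont]
  have h4 : 0 ≤ ∫ z, ∫ w, gaussianKernel u z w ∂sphereMeasure d ∂sphereMeasure d :=
    integral_nonneg fun z => integral_nonneg fun w => hpos z w
  have hsum : (∑ k, ∫ w, gaussianKernel u (p k) w ∂sphereMeasure d) / N ≤ δ := by
    rw [div_le_iff₀ hN0]
    refine (Finset.sum_le_card_nsmul _ _ _ fun k _ => hδ (p k)).trans_eq ?_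
    simp [mul_comm]
  have h2 : ∫ z, ∫ w, gaussianKernel u z w ∂sphereMeasure d ∂empiricalMeasure p ≤ δ := by
    rwa [integral_empiricalMeasure]
  have h3 : ∫ z, ∫ w, gaussianKernel u z w ∂empiricalMeasure p ∂sphereMeasure d ≤ δ := by
    simp only [integral_empiricalMeasure]
    have hi (k : Fin N) : Integrable (fun z => gaussianKernel u z (p k)) (sphereMeasure d) :=
      Continuous.integrable_sphereMeasure (by simp only [gaussianKernel]; fun_prop)
    rw [integral_div, integral_finsetSum _ fun k _ => hi k]
    have he (k : Fin N) : ∫ z, gaussianKernel u z (p k) ∂sphereMeasure d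
        = ∫ w, gaussianKernel u (p k) w ∂sphereMeasure d :=
      integral_congr_ae (.of_forall fun z => hsymm z (p k))
    rwa [Finset.sum_congr rfl fun k _ => he k]
  have h1 : 1 / (N : ℝ) ≤ ∫ z, ∫ w, gaussianKernel u z w ∂empiricalMeasure p
      ∂empiricalMeasure p := by
    simp only [integral_empiricalMeasure]
    refine div_le_div_of_nonneg_right ?_ hN0.le
    calc (1 : ℝ) = ∑ k : Fin N, 1 / (N : ℝ) := by simp [hN0.ne']
      _ ≤ _ := Finset.sum_le_sum fun k _ => by
        refine div_le_div_of_nonneg_right ((hself (p k)).symm.le.trans ?_) hN0.le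
        exact Finset.single_le_sum (f := fun j => gaussianKernel u (p k) (p j))
          (fun j _ => hpos _ _) (Finset.mem_univ k)
  linarith

theorem le_capDiscrepancy_sq {d N : ℕ} (hN : 1 ≤ N) (p : Fin N → UnitSphere d) {v : ℝ}
    (hv : 0 < v) (h : ∀ u, v < u → ∀ z : UnitSphere d,
      ∫ w, gaussianKernel u z w ∂sphereMeasure d ≤ 1 / (4 * N)) :
    meanAbsCoord d / (4 * gaussianMixtureConst) / (N * v) ≤ capDiscrepancy p ^ 2 := by
  have := isProbabilityMeasure_empiricalMeasure hN p
  have hN0 : (0 : ℝ) < N := by exact_mod_cast hN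
  set P := (empiricalMeasure p).prod (sphereMeasure d) with hP
  have hκ := gaussianMixtureConst_pos
  have hc := meanAbsCoord_pos d
  have hD : capDiscrepancy p ^ 2 = meanAbsCoord d / (2 * gaussianMixtureConst) *
      ∫ u in Set.Ioi (0 : ℝ),
        (∫ q, mixedDifference (gaussianKernel u) q ∂(P.prod P)) / u ^ 2 := by
    rw [← integral_mixedDifference_dist, capDiscrepancy_sq hN, ← hP]
    field_simp
  have hint := integrableOn_integral_mixedDifference_gaussianKernel_div (P.prod P)
  have hpow : IntegrableOn (fun u : ℝ => 1 / (2 * N) * u ^ (-2 : ℝ)) (Set.Ioi v) :=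
    Integrable.const_mul (integrableOn_Ioi_rpow_of_lt (by norm_num) hv) _
  have hlow : 1 / (2 * N * v) ≤ ∫ u in Set.Ioi (0 : ℝ),
      (∫ q, mixedDifference (gaussianKernel u) q ∂(P.prod P)) / u ^ 2 := by
    calc 1 / (2 * N * v) = ∫ u in Set.Ioi v, 1 / (2 * N) * u ^ (-2 : ℝ) := by
          rw [integral_const_mul, integral_Ioi_rpow_of_lt (by norm_num) hv]
          norm_num
          rw [Real.rpow_neg_one]
          ring
      _ ≤ ∫ u in Set.Ioi v,
            (∫ q, mixedDifference (gaussianKernel u) q ∂(P.prod P)) / u ^ 2 := by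
          refine setIntegral_mono_on hpow (hint.mono_set (Set.Ioi_subset_Ioi hv.le))
            measurableSet_Ioi fun u hu => ?_
          have hu0 : 0 < u := hv.trans hu
          rw [show (-2 : ℝ) = -(2 : ℕ) by norm_num, Real.rpow_neg hu0.le, Real.rpow_natCast,
            ← div_eq_mul_inv]
          refine div_le_div_of_nonneg_right (le_trans (le_of_eq ?_)
            (le_integral_mixedDifference_gaussianKernel hN p (h u hu))) (sq_nonneg u)
          field_simp
          norm_num
      _ ≤ _ := by
          -- Positive definiteness allows the range 0 < u ≤ v to be discarded.
          refine setIntegral_mono_set hint ?_ (Set.Ioi_subset_Ioi hv.le).eventuallyLE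
          filter_upwards [ae_restrict_mem measurableSet_Ioi] with u hu
          exact div_nonneg (integral_mixedDifference_gaussianKernel_nonneg hu P) (sq_nonneg u)
  rw [hD]
  refine le_trans (le_of_eq ?_) (mul_le_mul_of_nonneg_left hlow (by positivity))
  field_simp
  norm_num

theorem mainTheorem1 (d : ℕ) (hd : 2 ≤ d) :
    ∃ c : ℝ, 0 < c ∧ ∀ (N : ℕ), 1 ≤ N → ∀ p : Fin N → UnitSphere d,
      c * (N : ℝ) ^ (-(1 / 2 : ℝ) - 1 / (2 * (d : ℝ))) ≤ capDiscrepancy p := by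
  obtain ⟨C, hC, hgauss⟩ := exists_integral_gaussian_sphere_le d
  have hκ := gaussianMixtureConst_pos
  have hc := meanAbsCoord_pos d
  have hd0 : (0 : ℝ) < d := by exact_mod_cast (by omega : 0 < d)
  -- Chosen so that v^d = 4 C N, the threshold beyond which C / u^d ≤ 1 / (4 N).
  set A : ℝ := (4 * C) ^ (1 / (d : ℝ)) with hA
  have hA0 : 0 < A := by positivity
  set B : ℝ := meanAbsCoord d / (4 * gaussianMixtureConst) / A with hB
  refine ⟨Real.sqrt B, by positivity, fun N hN p => ?_⟩
  have hN0 : (0 : ℝ) < N := by exact_mod_cast hN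
  set v : ℝ := A * (N : ℝ) ^ (1 / (d : ℝ)) with hv
  have hv0 : 0 < v := by positivity
  have hvd : v ^ d = 4 * C * N := by
    rw [hv, hA, mul_pow, ← Real.rpow_mul_natCast (by positivity),
      ← Real.rpow_mul_natCast hN0.le, one_div_mul_cancel hd0.ne', Real.rpow_one, Real.rpow_one]
  have key := le_capDiscrepancy_sq hN p hv0 fun u hu z => by
    refine (hgauss u (hv0.trans hu) z).trans ?_
    have : v ^ d ≤ u ^ d := pow_le_pow_left₀ hv0.le hu.le d
    rw [div_le_div_iff₀ (pow_pos (hv0.trans hu) d) (by positivity)]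
    linarith
  have hD : 0 ≤ capDiscrepancy p := Real.sqrt_nonneg _
  refine le_of_sq_le_sq ?_ hD
  refine le_trans (le_of_eq ?_) key
  rw [mul_pow, Real.sq_sqrt (by positivity), ← Real.rpow_mul_natCast hN0.le, hB, hv,
    show (-(1 / 2 : ℝ) - 1 / (2 * (d : ℝ))) * (2 : ℕ) = -(1 + 1 / d) by push_cast; field_simp; ring,
    Real.rpow_neg hN0.le, Real.rpow_add hN0, Real.rpow_one]
  field_simp
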